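/- **Setting.** A simultaneous first-price auction has finite sets of bidders $N\neq\emptyset$ and items $M$. Every bidder $i$ submits a bid $b_{ij}\ge 0$ on every item $j$; each item goes to a bidder with the highest bid on it (ties are broken by an arbitrary measurable rule), who pays his bid. With $X_i(b)$ the bundle won by $i$, his utility is $v_i(X_i(b))-\sum_{j\in X_i(b)}b_{ij}$, where $v_i:2^M\to\mathbb{R}_{\ge 0}$ is his valuation (normalized and monotone). A mixed Nash equilibrium is a profile $B$ of independent random bid vectors under which no bidder can increase his expected utility by deviating to another bid vector. $\mathrm{Opt}(v)$ is the maximum of $\sum_i v_i(A_i)$ over all allocations $A$, and the price of anarchy of the instance $v$ is $$\sup_{B\ \text{mixed Nash equilibrium}}\ \frac{\mathrm{Opt}(v)}{\mathbb{E}_{b\sim B}\big[\sum_i v_i(X_i(b))\big]} .$$ A valuation is single-minded if, for some nonempty bundle $T$ and $w>0$, it equals $w$ on all $S\supseteq T$ and $0$ on all other $S$. It is in $\mathcal{MPH}$-$k$ if it is normalized, monotone, and a pointwise maximum of functions of the form $S\mapsto\sum_{T\subseteq S}h(T)$ with $h\ge 0$, $h(\emptyset)=0$, and $h(T)=0$ whenever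 $|T|>k$. **Theorem.** (a) Consider a finite projective plane with $k$ points on every line (that is, of order $k-1$). Take $k$ copies of it and let the items be the points of all the copies. For every line of every copy there is a bidder who values at $1$ the set of points of this line in this copy, and for every point $p$ of the plane there is an auxiliary bidder who values at $1$ the bundle that consists of the $k$ copies of $p$; all bidders are single-minded, and their valuations are in $\mathcal{MPH}$-$k$. The optimal welfare of this instance is $k(k-1)+1$. Suppose that every line bidder independently draws $x\in[0,\tfrac1k]$ with $\Pr[x\le t]=(kt)^{1/(k-1)^2}$ for $0\le t\le \tfrac1k$, bids $x$ on each item of his bundle and $0$ on all other items, and that the auxiliary bidders bid $0$ on all items. Then, for every tie-breaking rule, this is a mixed Nash equilibrium, and its expected welfare is $k$. (So the ratio of the optimal to the equilibrium welfare is $k-1+\tfrac1k$.) (b) There is a constant $c>0$ such that for every integer $k\ge 1$ there is an instance of the simultaneous first-price auction in which all bidders are single-minded and have valuations in $\mathcal{MPH}$-$k$, and whose price of anarchy is at least $c\,k$ under every tie-breaking rule. -/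

import Mathlib

open MeasureTheory
open scoped NNReal ENNReal

noncomputable section

namespace FirstPrice

/-! ### Valuations -/

section Valuations

variable {M : Type*}

/-- `f` is a positive hypergraph function of rank at most `k`: its hypergraph representation `h`
is normalized and non-negative, and all hyperedges have at most `k` elements. -/
def IsPH (k : ℕ) (f : Finset M → ℝ) : Prop :=
  ∃ h : Finset M → ℝ, h ∅ = 0 ∧ (∀ T, 0 ≤ h T) ∧ (∀ T, k < T.card → h T = 0) ∧
    ∀ S, f S = ∑ T ∈ S.powerset, h T

/-- `v` is a (normalized, monotone) valuation in the class MPH-`k`: it is the pointwise maximum of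
a set of positive hypergraph functions of rank at most `k`. -/
def IsMPH (k : ℕ) (v : Finset M → ℝ) : Prop :=
  v ∅ = 0 ∧ Monotone v ∧
    ∃ 𝓛 : Set (Finset M → ℝ), (∀ f ∈ 𝓛, IsPH k f) ∧
      ∀ S, IsGreatest ((fun f : Finset M → ℝ => f S) '' 𝓛) (v S)

open Classical in
/-- The valuation of a bidder that wants exactly the bundle `T` and values it at `w`. -/
def bundleValue (T : Finset M) (w : ℝ) (S : Finset M) : ℝ := if T ⊆ S then w else 0

/-- A single-minded bidder wants one particular nonempty bundle. -/
def IsSingleMinded (v : Finset M → ℝ) : Prop :=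
  ∃ (T : Finset M) (w : ℝ), T.Nonempty ∧ 0 < w ∧ v = bundleValue T w

end Valuations

/-! ### The simultaneous first-price auction

`N` is the set of bidders and `M` the set of items. A bid profile is `b : N → M → ℝ≥0`, and an
allocation is a map `A : M → N` that assigns every item to a bidder. -/

section Auction

variable {N M : Type*} [Fintype N] [Fintype M]

open Classical in
/-- The bundle that bidder `i` gets in the allocation `A`. -/
def bundle (A : M → N) (i : N) : Finset M := Finset.univ.filter fun j => A j = i

/-- The social welfare of an allocation. -/
def welfare (v : N → Finset M → ℝ) (A : M → N) : ℝ := ∑ i, v i (bundle A i)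

/-- The optimal welfare. -/
def opt (v : N → Finset M → ℝ) : ℝ := ⨆ A : M → N, welfare v A

variable (N M) in
/-- An allocation rule of the auction: every item goes to one of the bidders with the highest bid
on it; ties are broken in an arbitrary (measurable) way. -/
structure AllocationRule where
  /-- the winner of each item under a bid profile -/
  winner : (N → M → ℝ≥0) → M → N
  highest : ∀ (b : N → M → ℝ≥0) (j : M) (i : N), b i j ≤ b (winner b j) j
  measurable_winner : ∀ j i, MeasurableSet {b | winner b j = i}

/-- Quasi-linear utility: the value of the bundle won, minus the bids on the items won. -/
def utility (X : AllocationRule N M) (v : N → Finset M → ℝ) (i : N) (b : N → M → ℝ≥0) : ℝ :=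
  v i (bundle (X.winner b) i) - ∑ j ∈ bundle (X.winner b) i, (b i j : ℝ)

open Classical in
/-- `B` is a mixed Nash equilibrium: the bidders draw their bid vectors independently, bidder `i`
from the distribution `B i`; expected utilities exist (as finite numbers), and no bidder can
increase his expected utility by deviating to some other bid vector. -/
structure IsMixedNash (X : AllocationRule N M) (v : N → Finset M → ℝ)
    (B : N → Measure (M → ℝ≥0)) : Prop where
  isProbabilityMeasure : ∀ i, IsProbabilityMeasure (B i)
  integrable : ∀ i, Integrable (utility X v i) (Measure.pi B)
  best_response : ∀ (i : N) (d : M → ℝ≥0),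
    ∫ b, utility X v i (Function.update b i d) ∂(Measure.pi B)
      ≤ ∫ b, utility X v i b ∂(Measure.pi B)

/-- The expected welfare when the bids are drawn independently from the distributions `B i`. -/
def expectedWelfare (X : AllocationRule N M) (v : N → Finset M → ℝ)
    (B : N → Measure (M → ℝ≥0)) : ℝ :=
  ∫ b, welfare v (X.winner b) ∂(Measure.pi B)

/-- The price of anarchy of the instance `v`: the supremum, over its mixed Nash equilibria, of the
optimal welfare divided by the expected welfare at the equilibrium. -/
def priceOfAnarchy (X : AllocationRule N M) (v : N → Finset M → ℝ) : ℝ≥0∞ :=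
  ⨆ (B : N → Measure (M → ℝ≥0)) (_ : IsMixedNash X v B),
    ENNReal.ofReal (opt v) / ENNReal.ofReal (expectedWelfare X v B)

end Auction

/-! ### The instance built from `k` copies of a projective plane

The items are the points of the `k` copies, `Fin k × P`. There is one bidder for every line of
every copy, `Fin k × L`, and one auxiliary bidder for every point of the plane, `P`. -/

section Plane

variable {P L : Type*} [Fintype P] [Membership P L]

open Classical in
/-- The desired bundles: a line bidder wants the points of his line, in his copy of the plane;
the auxiliary bidder `p` wants the point `p` of every copy. -/
def planeBundle (k : ℕ) : (Fin k × L) ⊕ P → Finset (Fin k × P)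
  | .inl (c, l) => Finset.univ.filter fun j => j.1 = c ∧ j.2 ∈ l
  | .inr p => Finset.univ.filter fun j => j.2 = p

/-- Every bidder values his desired bundle at `1`. -/
def planeValuation (k : ℕ) (i : (Fin k × L) ⊕ P) : Finset (Fin k × P) → ℝ :=
  bundleValue (planeBundle k i) 1

open Classical in
/-- The bid vector with the equal bid `x` on all items of `T`, and `0` on all other items. -/
def equalBid {M : Type*} (T : Finset M) (x : ℝ≥0) : M → ℝ≥0 := fun j => if j ∈ T then x else 0

/-- The equal-bid strategies: a line bidder draws `x` from `μ` and bids `x` on every item of his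
bundle; an auxiliary bidder does not bid (he bids `0` on every item). -/
def planeStrategy (k : ℕ) (μ : Measure ℝ≥0) :
    (Fin k × L) ⊕ P → Measure (Fin k × P → ℝ≥0)
  | .inl a => μ.map (equalBid (planeBundle k (Sum.inl a : (Fin k × L) ⊕ P)))
  | .inr _ => Measure.dirac 0

end Plane

end FirstPrice

end

/-!
The draws of the bidders can be realized as independent variables `x a` with a common atomless
distribution `μ`, so that bidder `a` bids `x a` on the items of a set `S a`: his bundle for a line
bidder, the empty set for an auxiliary bidder. Write `F` for the distribution function of `μ`.
A bidder `i` who bids `d j` on the item `j` of his bundle wins it, up to a null set of ties, when the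
draws of all `c` competitors on `j` are at most `d j`. On different items of his bundle these
competitors are different bidders: two lines of a plane meet in one point, and no line bidder
competes in two copies. Hence the expected utility of the deviation is at most
`∏ j, F (d j) ^ c - ∑ j, d j * F (d j) ^ c` (`integral_utility_update_le`).

With `m = (k - 1) ^ 2` the distribution satisfies `F t ^ m ≤ k t`, with equality on `[0, 1 / k]`, so
the sum is at least `(1 / k) ∑ j, F (d j) ^ (m + c)`. As `m + c ≤ k c`, both for line bidders
(`c = k - 1`, with equality) and for auxiliary bidders (`c = k`), the AM-GM inequality shows that no
deviation earns more than `0` (`prod_pow_le_sum_mul_pow`). In the strategy profile itself the line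
bidders earn `0` because AM-GM is tight for equal bids, and the auxiliary bidders pay nothing, so the
profile is an equilibrium (`isMixedNash_planeStrategy`).

Almost surely all draws are distinct and positive. Then in each copy the line with the highest draw
wins its bundle; every other line meets it and loses a point, and every auxiliary bidder loses to the
lines. So the welfare is `k` almost surely (`welfare_equalBids_planeSupport`). The optimum serves all
`k (k - 1) + 1` auxiliary bidders, and no allocation does better, since all bundles have `k` of the
`k (k (k - 1) + 1)` items (`opt_planeValuation`).

For the linear lower bound on the price of anarchy, Bertrand's postulate gives a prime `p` with
`p + 1 ≤ k ≤ 2 p`, and the plane over `ZMod p` has ratio at least `p ≥ k / 2`. For `k ≤ 2` one bidder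
and one item suffice.
-/

noncomputable section

namespace FirstPrice

open Set Function Configuration ProjectivePlane

/-! ### Independent draws from a common distribution -/

section Prob

variable {N : Type*} [Fintype N] (μ : Measure ℝ≥0) [IsProbabilityMeasure μ]

open Classical in
/-- Replacing one coordinate of independent, identically distributed draws by a fresh draw does not
change their joint distribution. -/
theorem measurePreserving_update (i : N) :
    MeasurePreserving (fun p : ℝ≥0 × (N → ℝ≥0) => update p.2 i p.1)
      (μ.prod (Measure.pi fun _ => μ)) (Measure.pi fun _ => μ) := by
  have hm : Measurable (fun p : ℝ≥0 × (N → ℝ≥0) => update p.2 i p.1) := by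
    refine measurable_pi_lambda _ fun a => ?_
    by_cases h : a = i
    · subst h; simpa using measurable_fst
    · simp only [update_of_ne h]
      exact (measurable_pi_apply a).comp measurable_snd
  refine ⟨hm, (Measure.pi_eq fun s hs => ?_).symm⟩
  rw [Measure.map_apply hm (.univ_pi hs)]
  have : (fun p : ℝ≥0 × (N → ℝ≥0) => update p.2 i p.1) ⁻¹' univ.pi s
      = s i ×ˢ univ.pi (update s i univ) := by
    ext p
    simp only [mem_preimage, mem_univ_pi, mem_prod]
    constructor
    · intro h
      refine ⟨by simpa using h i, fun a => ?_⟩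
      by_cases ha : a = i
      · subst ha; simp
      · simpa [ha] using h a
    · rintro ⟨h1, h2⟩ a
      by_cases ha : a = i
      · subst ha; simpa using h1
      · simpa [ha] using h2 a
  rw [this, Measure.prod_prod, Measure.pi_pi, ← Finset.mul_prod_erase _ _ (Finset.mem_univ i),
    ← Finset.mul_prod_erase _ (fun a => μ (s a)) (Finset.mem_univ i)]
  simp only [update_self, measure_univ, one_mul]
  congr 1
  exact Finset.prod_congr rfl fun a ha => by rw [update_of_ne (Finset.ne_of_mem_erase ha)]

theorem ae_injective [NullSingletonClass μ] : ∀ᵐ x ∂(Measure.pi fun _ : N => μ), Injective x := by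
  classical
  have : ∀ a a' : N, a ≠ a' → ∀ᵐ x ∂(Measure.pi fun _ : N => μ), x a ≠ x a' := by
    intro a a' h
    have hs : MeasurableSet {x : N → ℝ≥0 | x a = x a'} :=
      measurableSet_eq_fun (measurable_pi_apply a) (measurable_pi_apply a')
    rw [ae_iff]
    simp only [ne_eq, not_not]
    have hmp := measurePreserving_update μ a
    rw [← hmp.measure_preimage hs.nullMeasurableSet,
      Measure.prod_apply_symm (hmp.measurable hs)]
    refine (lintegral_eq_zero_iff' ?_).2 (.of_forall fun x => ?_)
    · exact (measurable_measure_prodMk_right (hmp.measurable hs)).aemeasurable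
    · have : (fun t => (t, x)) ⁻¹' ((fun p : ℝ≥0 × (N → ℝ≥0) => update p.2 a p.1) ⁻¹'
          {x : N → ℝ≥0 | x a = x a'}) = {x a'} := by
        ext t; simp [h.symm]
      simp only [this, measure_singleton, Pi.zero_apply]
  have h2 : ∀ᵐ x ∂(Measure.pi fun _ : N => μ), ∀ a a' : N, a ≠ a' → x a ≠ x a' := by
    simp only [ae_all_iff]; exact this
  filter_upwards [h2] with x hx a a' h
  by_contra hne
  exact hx a a' hne h

theorem ae_forall_pi {p : ℝ≥0 → Prop} (h : ∀ᵐ t ∂μ, p t) :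
    ∀ᵐ x ∂(Measure.pi fun _ : N => μ), ∀ a : N, p (x a) :=
  ae_all_iff.2 fun a =>
    (measurePreserving_eval (fun _ : N => μ) a).quasiMeasurePreserving.ae h

/-- If the coordinates are independent with distribution `μ`, and the index sets `C j` are
pairwise disjoint, then the constraints that the coordinates in `C j` lie in `R j` are
independent. -/
theorem measureReal_pi_forall_mem {M : Type*} (T : Finset M) (C : M → Finset N)
    (hC : (T : Set M).PairwiseDisjoint C) (R : M → Set ℝ≥0) :
    (Measure.pi fun _ : N => μ).real {x | ∀ j ∈ T, ∀ a ∈ C j, x a ∈ R j}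
      = ∏ j ∈ T, μ.real (R j) ^ (C j).card := by
  classical
  have : {x : N → ℝ≥0 | ∀ j ∈ T, ∀ a ∈ C j, x a ∈ R j}
      = univ.pi fun a => {t | ∀ j ∈ T, a ∈ C j → t ∈ R j} := by
    ext x; simp only [mem_ofPred_eq, mem_univ_pi]; tauto
  rw [measureReal_def, this, Measure.pi_pi, ENNReal.toReal_prod]
  rw [← Finset.prod_subset (Finset.subset_univ (T.biUnion C)), Finset.prod_biUnion hC]
  · refine Finset.prod_congr rfl fun j hj => ?_
    rw [← Finset.prod_const]
    refine Finset.prod_congr rfl fun a ha => ?_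
    rw [measureReal_def]
    congr 2
    ext t
    refine ⟨fun h => h j hj ha, fun h j' hj' ha' => ?_⟩
    have : j = j' := hC.elim_finset hj hj' a ha ha'
    exact this ▸ h
  · intro a _ ha
    have : {t | ∀ j ∈ T, a ∈ C j → t ∈ R j} = univ := by
      ext t
      simp only [mem_ofPred_eq, mem_univ, iff_true]
      intro j hj h
      exact absurd (Finset.mem_biUnion.2 ⟨j, hj, h⟩) ha
    simp [this]

end Prob

/-! ### Measurability of outcomes and utilities -/

section Measurability

variable {N M : Type*} [Fintype M]

theorem measurableSet_winner_eq (X : AllocationRule N M) (A : M → N) :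
    MeasurableSet {b | X.winner b = A} := by
  have : {b | X.winner b = A} = ⋂ j, {b | X.winner b j = A j} := by
    ext b; simp [funext_iff]
  rw [this]
  exact .iInter fun j => X.measurable_winner j _

theorem measurable_comp_winner [Fintype N] (X : AllocationRule N M) (f : (M → N) → ℝ) :
    Measurable fun b => f (X.winner b) := by
  classical
  have : (fun b => f (X.winner b)) =
      fun b => ∑ A : M → N, {b | X.winner b = A}.indicator (fun _ => f A) b := by
    ext b
    simp [indicator_apply]
  rw [this]
  exact Finset.measurable_sum _ fun A _ => measurable_const.indicator (measurableSet_winner_eq X A)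

theorem measurable_utility [Fintype N] (X : AllocationRule N M) (v : N → Finset M → ℝ) (i : N) :
    Measurable (utility X v i) := by
  classical
  unfold utility
  refine (measurable_comp_winner X fun A => v i (bundle A i)).sub ?_
  simp only [bundle, Finset.sum_filter]
  refine Finset.measurable_sum _ fun j _ => Measurable.ite (X.measurable_winner j i) ?_
    measurable_const
  exact measurable_coe_nnreal_real.comp ((measurable_pi_apply j).comp (measurable_pi_apply i))

end Measurability

/-! ### Equal bids, and bounds on the utility of a deviation -/

section EqualBids

variable {M : Type*}

theorem measurable_equalBid (T : Finset M) : Measurable (equalBid T) := by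
  classical
  refine measurable_pi_lambda _ fun j => ?_
  by_cases h : j ∈ T
  · simpa [equalBid, h] using measurable_id'
  · simp [equalBid, h]

@[simp] theorem equalBid_of_mem {T : Finset M} {j : M} (h : j ∈ T) (t : ℝ≥0) :
    equalBid T t j = t := by simp [equalBid, h]

@[simp] theorem equalBid_of_notMem {T : Finset M} {j : M} (h : j ∉ T) (t : ℝ≥0) :
    equalBid T t j = 0 := by simp [equalBid, h]

theorem equalBid_le (T : Finset M) (t : ℝ≥0) (j : M) : equalBid T t j ≤ t := by
  by_cases h : j ∈ T <;> simp [h]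

@[simp] theorem equalBid_empty (t : ℝ≥0) : equalBid (∅ : Finset M) t = 0 := by
  ext j; simp

variable {N : Type*}

open Classical in
/-- The bidders other than `i` whose bid on the item `j` is the number they draw, when bidder `a`
bids on the items of `S a` only. -/
def competitors [Fintype N] (S : N → Finset M) (i : N) (j : M) : Finset N :=
  Finset.univ.filter fun a => a ≠ i ∧ j ∈ S a

theorem mem_competitors [Fintype N] {S : N → Finset M} {i a : N} {j : M} :
    a ∈ competitors S i j ↔ a ≠ i ∧ j ∈ S a := by
  simp [competitors]

/-- The bid profile in which bidder `a` bids `x a` on all items of `S a`. -/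
def equalBids (S : N → Finset M) (x : N → ℝ≥0) (a : N) : M → ℝ≥0 := equalBid (S a) (x a)

theorem measurable_equalBids (S : N → Finset M) : Measurable (equalBids S) :=
  measurable_pi_lambda _ fun a => (measurable_equalBid (S a)).comp (measurable_pi_apply a)

/-- The product of the bid distributions is the image of the joint distribution of the draws. -/
theorem measurePreserving_equalBids [Fintype N] (μ : Measure ℝ≥0) [IsProbabilityMeasure μ]
    (S : N → Finset M) :
    MeasurePreserving (equalBids S) (Measure.pi fun _ => μ)
      (Measure.pi fun a => μ.map (equalBid (S a))) := by
  have : ∀ a, IsProbabilityMeasure (μ.map (equalBid (S a))) := fun a =>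
    Measure.isProbabilityMeasure_map (measurable_equalBid _).aemeasurable
  exact ⟨measurable_equalBids S,
    Measure.pi_map_pi fun a => (measurable_equalBid (S a)).aemeasurable⟩

open Classical in
theorem equalBids_update (S : N → Finset M) (x : N → ℝ≥0) (i : N) (t : ℝ≥0) :
    equalBids S (update x i t) = update (equalBids S x) i (equalBid (S i) t) := by
  funext a
  by_cases h : a = i
  · subst h; simp [equalBids]
  · simp [equalBids, h]

theorem mem_bundle [Fintype M] {A : M → N} {i : N} {j : M} : j ∈ bundle A i ↔ A j = i := by
  simp [bundle]

theorem abs_utility_bundleValue_le [Fintype M] (X : AllocationRule N M) (T : N → Finset M) (i : N)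
    (b : N → M → ℝ≥0) :
    |utility X (fun i => bundleValue (T i) 1) i b| ≤ 1 + ∑ j, (b i j : ℝ) := by
  have h1 : 0 ≤ bundleValue (T i) 1 (bundle (X.winner b) i) ∧
      bundleValue (T i) 1 (bundle (X.winner b) i) ≤ 1 := by
    unfold bundleValue; split_ifs <;> simp
  have h2 : ∑ j ∈ bundle (X.winner b) i, (b i j : ℝ) ≤ ∑ j, (b i j : ℝ) :=
    Finset.sum_le_sum_of_subset_of_nonneg (Finset.subset_univ _) fun _ _ _ => by positivity
  have h3 : 0 ≤ ∑ j ∈ bundle (X.winner b) i, (b i j : ℝ) := Finset.sum_nonneg fun _ _ => by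
    positivity
  unfold utility
  rw [abs_le]
  constructor <;> linarith [h1.1, h1.2]

open Classical in
theorem winner_eq_of_lt [Fintype N] {X : AllocationRule N M} {S : N → Finset M} {x : N → ℝ≥0}
    {i : N} {d : M → ℝ≥0} {j : M} (hd : 0 < d j) (h : ∀ a ∈ competitors S i j, x a < d j) :
    X.winner (update (equalBids S x) i d) j = i := by
  by_contra hne
  have := X.highest (update (equalBids S x) i d) j i
  rw [update_self, update_of_ne hne] at this
  by_cases hj : j ∈ S (X.winner (update (equalBids S x) i d) j)
  · have h2 := h _ (mem_competitors.2 ⟨hne, hj⟩)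
    rw [equalBids, equalBid_of_mem hj] at this
    exact absurd h2 (not_lt.2 this)
  · rw [equalBids, equalBid_of_notMem hj] at this
    exact absurd hd (not_lt.2 this)

open Classical in
theorem le_of_winner_eq [Fintype N] {X : AllocationRule N M} {S : N → Finset M} {x : N → ℝ≥0}
    {i : N} {d : M → ℝ≥0} {j : M} (h : X.winner (update (equalBids S x) i d) j = i) :
    ∀ a ∈ competitors S i j, x a ≤ d j := by
  intro a ha
  obtain ⟨hne, hj⟩ := mem_competitors.1 ha
  have := X.highest (update (equalBids S x) i d) j a
  rw [h, update_self, update_of_ne hne, equalBids, equalBid_of_mem hj] at this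
  exact this

open Classical in
/-- Pointwise upper bound on the utility of a deviation. Ties are counted in favour of bidder `i` in
his value and against him in his payments, so the tie-breaking rule does not enter. -/
theorem utility_update_le [Fintype N] [Fintype M] (X : AllocationRule N M) (T S : N → Finset M)
    (i : N) (d : M → ℝ≥0) (x : N → ℝ≥0) :
    utility X (fun i => bundleValue (T i) 1) i (update (equalBids S x) i d) ≤
      {x : N → ℝ≥0 | ∀ j ∈ T i, ∀ a ∈ competitors S i j, x a ∈ Iic (d j)}.indicator 1 x
      - ∑ j ∈ T i, (d j : ℝ) *
        {x : N → ℝ≥0 | ∀ j' ∈ ({j} : Finset M), ∀ a ∈ competitors S i j',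
          x a ∈ Iio (d j')}.indicator 1 x := by
  unfold utility
  refine sub_le_sub ?_ ?_
  · simp only [bundleValue]
    split_ifs with h
    · rw [indicator_of_mem]
      · rfl
      · intro j hj
        exact le_of_winner_eq (mem_bundle.1 (h hj))
    · exact indicator_nonneg (fun _ _ => zero_le_one) _
  · simp only [update_self]
    calc _ ≤ ∑ j ∈ T i with X.winner (update (equalBids S x) i d) j = i, (d j : ℝ) := by
          rw [Finset.sum_filter]
          refine Finset.sum_le_sum fun j _ => ?_
          by_cases hx : x ∈ {x : N → ℝ≥0 | ∀ j' ∈ ({j} : Finset M), ∀ a ∈ competitors S i j',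
            x a ∈ Iio (d j')}
          · rw [indicator_of_mem hx, Pi.one_apply, mul_one]
            rcases eq_or_ne (d j) 0 with h0 | h0
            -- a bid of `0` may lose to a bidder outside the competitors, but costs nothing
            · simp [h0]
            · rw [if_pos (winner_eq_of_lt (pos_iff_ne_zero.2 h0) (hx j (by simp)))]
          · rw [indicator_of_notMem hx, mul_zero]
            split_ifs <;> positivity
      _ ≤ _ := by
          refine Finset.sum_le_sum_of_subset_of_nonneg (fun j hj => ?_) fun _ _ _ => by positivity
          exact mem_bundle.2 (Finset.mem_filter.1 hj).2

open Classical in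
/-- Pointwise lower bound on the utility of a positive equal bid on the desired bundle, with ties
counted the other way round than in `utility_update_le`. -/
theorem le_utility_update_equalBid [Fintype N] [Fintype M] (X : AllocationRule N M)
    (T S : N → Finset M) (i : N) {t : ℝ≥0} (ht : 0 < t) (x : N → ℝ≥0) :
      {x : N → ℝ≥0 | ∀ j ∈ T i, ∀ a ∈ competitors S i j, x a ∈ Iio t}.indicator 1 x
      - ∑ j ∈ T i, (t : ℝ) *
        {x : N → ℝ≥0 | ∀ j' ∈ ({j} : Finset M), ∀ a ∈ competitors S i j',
          x a ∈ Iic t}.indicator 1 x ≤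
    utility X (fun i => bundleValue (T i) 1) i (update (equalBids S x) i (equalBid (T i) t)) := by
  unfold utility
  refine sub_le_sub ?_ ?_
  · simp only [bundleValue]
    by_cases hx : x ∈ {x : N → ℝ≥0 | ∀ j ∈ T i, ∀ a ∈ competitors S i j, x a ∈ Iio t}
    · rw [if_pos]
      · exact indicator_le_self' (fun _ _ => zero_le_one) _
      · intro j hj
        refine mem_bundle.2 (winner_eq_of_lt ?_ ?_) <;> rw [equalBid_of_mem hj]
        · exact ht
        · exact hx j hj
    · rw [indicator_of_notMem hx]
      split_ifs <;> simp
  · simp only [update_self]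
    rw [← Finset.sum_filter_add_sum_filter_not (bundle _ _) (· ∈ T i)]
    rw [Finset.sum_eq_zero (s := Finset.filter (· ∉ T i) _) (fun j hj => by
      rw [equalBid_of_notMem (Finset.mem_filter.1 hj).2, NNReal.coe_zero]), add_zero]
    rw [Finset.filter_mem_eq_inter, Finset.inter_comm, ← Finset.filter_mem_eq_inter,
      Finset.sum_filter]
    refine Finset.sum_le_sum fun j hj => ?_
    split_ifs with h
    · rw [indicator_of_mem, Pi.one_apply, mul_one, equalBid_of_mem hj]
      intro j' hj' a ha
      rw [Finset.mem_singleton] at hj'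
      subst hj'
      have := le_of_winner_eq (mem_bundle.1 h) a ha
      rwa [equalBid_of_mem hj] at this
    · exact mul_nonneg t.2 (indicator_nonneg (fun _ _ => zero_le_one) _)

/-- The common form of the bounds on the utility in `utility_update_le` and
`le_utility_update_equalBid`, and its expectation. -/
theorem integral_indicator_sub_sum [Fintype N] (μ : Measure ℝ≥0) [IsProbabilityMeasure μ]
    (T : Finset M) (C : M → Finset N)
    (hC : (T : Set M).PairwiseDisjoint C) (d : M → ℝ≥0) (R R' : M → Set ℝ≥0)
    (hR : ∀ j, MeasurableSet (R j)) (hR' : ∀ j, MeasurableSet (R' j)) :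
    Integrable (fun x =>
        {x : N → ℝ≥0 | ∀ j ∈ T, ∀ a ∈ C j, x a ∈ R j}.indicator (1 : (N → ℝ≥0) → ℝ) x
      - ∑ j ∈ T, (d j : ℝ) *
        {x : N → ℝ≥0 | ∀ j' ∈ ({j} : Finset M), ∀ a ∈ C j', x a ∈ R' j'}.indicator 1 x)
      (Measure.pi fun _ : N => μ) ∧
    ∫ x, ({x : N → ℝ≥0 | ∀ j ∈ T, ∀ a ∈ C j, x a ∈ R j}.indicator (1 : (N → ℝ≥0) → ℝ) x
      - ∑ j ∈ T, (d j : ℝ) *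
        {x : N → ℝ≥0 | ∀ j' ∈ ({j} : Finset M), ∀ a ∈ C j', x a ∈ R' j'}.indicator 1 x)
      ∂(Measure.pi fun _ : N => μ)
    = ∏ j ∈ T, μ.real (R j) ^ (C j).card - ∑ j ∈ T, d j * μ.real (R' j) ^ (C j).card := by
  have hms : ∀ (T : Finset M) (R : M → Set ℝ≥0), (∀ j, MeasurableSet (R j)) →
      MeasurableSet {x : N → ℝ≥0 | ∀ j ∈ T, ∀ a ∈ C j, x a ∈ R j} := by
    intro T R hR
    simp only [ofPred_forall]
    exact T.measurableSet_biInter fun j _ => Finset.measurableSet_biInter _ fun a _ =>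
      measurable_pi_apply a (hR j)
  have hint : ∀ (T : Finset M) (R : M → Set ℝ≥0), (∀ j, MeasurableSet (R j)) →
      Integrable ({x : N → ℝ≥0 | ∀ j ∈ T, ∀ a ∈ C j, x a ∈ R j}.indicator (1 : (N → ℝ≥0) → ℝ))
        (Measure.pi fun _ : N => μ) := fun T R hR =>
    (integrable_const (1 : ℝ)).indicator (hms T R hR)
  have hsum : ∀ j ∈ T, Integrable (fun x => (d j : ℝ) *
        {x : N → ℝ≥0 | ∀ j' ∈ ({j} : Finset M), ∀ a ∈ C j', x a ∈ R' j'}.indicator 1 x)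
      (Measure.pi fun _ : N => μ) := fun j _ => (hint {j} R' hR').const_mul _
  refine ⟨(hint T R hR).sub (integrable_finsetSum _ hsum), ?_⟩
  rw [integral_sub (hint T R hR) (integrable_finsetSum _ hsum), integral_finsetSum _ hsum,
    integral_indicator_one (hms T R hR), measureReal_pi_forall_mem μ T C hC R]
  congr 1
  refine Finset.sum_congr rfl fun j hj => ?_
  rw [integral_const_mul, integral_indicator_one (hms {j} R' hR'),
    measureReal_pi_forall_mem μ {j} C (by simp) R', Finset.prod_singleton]

end EqualBids

/-! ### Equilibria in equal-bid strategies -/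

section Nash

variable {N M : Type*} [Fintype N] [Fintype M] (μ : Measure ℝ≥0) [IsProbabilityMeasure μ]

theorem integrable_utility_equalBids (X : AllocationRule N M) (T S : N → Finset M) (i : N)
    {r : ℝ≥0} (hr : ∀ᵐ t ∂μ, t ≤ r) :
    Integrable (fun x => utility X (fun i => bundleValue (T i) 1) i (equalBids S x))
      (Measure.pi fun _ : N => μ) := by
  refine Integrable.of_bound (C := 1 + ∑ _j : M, (r : ℝ))
    ((measurable_utility X _ i).comp (measurable_equalBids S)).aestronglyMeasurable ?_
  filter_upwards [ae_forall_pi (N := N) μ hr] with x hx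
  refine (abs_utility_bundleValue_le X T i _).trans ?_
  gcongr
  exact (equalBid_le (S i) (x i) _).trans (hx i)

open Classical in
theorem integrable_utility_update (X : AllocationRule N M) (T S : N → Finset M) (i : N)
    (d : M → ℝ≥0) :
    Integrable (fun x => utility X (fun i => bundleValue (T i) 1) i (update (equalBids S x) i d))
      (Measure.pi fun _ : N => μ) := by
  have hm : Measurable fun x : N → ℝ≥0 => update (equalBids S x) i d := by
    refine measurable_pi_lambda _ fun a => ?_
    by_cases h : a = i
    · subst h; simp
    · simp only [update_of_ne h]
      exact (measurable_pi_apply a).comp (measurable_equalBids S)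
  refine Integrable.of_bound (C := 1 + ∑ j : M, (d j : ℝ))
    ((measurable_utility X _ i).comp hm).aestronglyMeasurable (.of_forall fun x => ?_)
  refine (abs_utility_bundleValue_le X T i _).trans ?_
  simp

open Classical in
/-- The expected utility of a deviation `d` is at most what bidder `i` would get if he won
each item `j` of his bundle exactly when the draws of all competitors on it are at most `d j`. -/
theorem integral_utility_update_le [NullSingletonClass μ] (X : AllocationRule N M)
    (T S : N → Finset M) (i : N) (hC : (T i : Set M).PairwiseDisjoint (competitors S i))
    (d : M → ℝ≥0) :
    ∫ x, utility X (fun i => bundleValue (T i) 1) i (update (equalBids S x) i d)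
        ∂(Measure.pi fun _ : N => μ)
      ≤ ∏ j ∈ T i, μ.real (Iic (d j)) ^ (competitors S i j).card
        - ∑ j ∈ T i, d j * μ.real (Iic (d j)) ^ (competitors S i j).card := by
  have h := integral_indicator_sub_sum μ (T i) (competitors S i) hC d (fun j => Iic (d j))
    (fun j => Iio (d j)) (fun _ => measurableSet_Iic) (fun _ => measurableSet_Iio)
  refine (integral_mono (integrable_utility_update μ X T S i d) h.1
    (utility_update_le X T S i d)).trans (h.2.trans_le ?_)
  simp only [measureReal_congr (Iio_ae_eq_Iic (μ := μ)), le_refl]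

open Classical in
/-- For a positive equal bid on the desired bundle, the bound of `integral_utility_update_le` is
also a lower bound. -/
theorem le_integral_utility_update [NullSingletonClass μ] (X : AllocationRule N M)
    (T S : N → Finset M) (i : N) (hC : (T i : Set M).PairwiseDisjoint (competitors S i))
    {t : ℝ≥0} (ht : 0 < t) :
    ∏ j ∈ T i, μ.real (Iic t) ^ (competitors S i j).card
        - ∑ j ∈ T i, t * μ.real (Iic t) ^ (competitors S i j).card
      ≤ ∫ x, utility X (fun i => bundleValue (T i) 1) i
          (update (equalBids S x) i (equalBid (T i) t)) ∂(Measure.pi fun _ : N => μ) := by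
  have h := integral_indicator_sub_sum μ (T i) (competitors S i) hC (fun _ => t) (fun _ => Iio t)
    (fun _ => Iic t) (fun _ => measurableSet_Iio) (fun _ => measurableSet_Iic)
  refine le_trans ?_ (h.2.symm.trans_le (integral_mono h.1 (integrable_utility_update μ X T S i _)
    (le_utility_update_equalBid X T S i ht)))
  simp only [measureReal_congr (Iio_ae_eq_Iic (μ := μ)), le_refl]

/-- A bidder who bids on his bundle expects a non-negative utility if almost every bid that he draws
earns one; this follows by conditioning on his draw. -/
theorem integral_utility_equalBids_nonneg [NullSingletonClass μ] (X : AllocationRule N M)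
    (T S : N → Finset M) (i : N) (hS : S i = T i)
    (hC : (T i : Set M).PairwiseDisjoint (competitors S i))
    {r : ℝ≥0} (hr : ∀ᵐ t ∂μ, t ≤ r)
    (h : ∀ᵐ t ∂μ, ∑ j ∈ T i, t * μ.real (Iic t) ^ (competitors S i j).card ≤
      ∏ j ∈ T i, μ.real (Iic t) ^ (competitors S i j).card) :
    0 ≤ ∫ x, utility X (fun i => bundleValue (T i) 1) i (equalBids S x)
        ∂(Measure.pi fun _ : N => μ) := by
  classical
  have hmp := measurePreserving_update μ i
  have hint := integrable_utility_equalBids μ X T S i hr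
  rw [← hmp.map_eq, integral_map hmp.aemeasurable
    (by rw [hmp.map_eq]; exact hint.aestronglyMeasurable),
    integral_prod (fun p : ℝ≥0 × (N → ℝ≥0) => utility X (fun i => bundleValue (T i) 1) i
      (equalBids S (update p.2 i p.1))) (hmp.integrable_comp_of_integrable hint)]
  refine integral_nonneg_of_ae ?_
  have h0 : ∀ᵐ t ∂μ, t ≠ 0 := ae_iff.2 (by simp)
  filter_upwards [h, h0] with t ht ht0
  simp only [equalBids_update, hS]
  exact (sub_nonneg.2 ht).trans (le_integral_utility_update μ X T S i hC (pos_iff_ne_zero.2 ht0))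

/-- Sufficient conditions for equal-bid strategies to form a mixed Nash equilibrium: no deviation
has a positive expected utility, and the equilibrium utilities are non-negative. -/
theorem isMixedNash_equalBid [NullSingletonClass μ] (X : AllocationRule N M) (T S : N → Finset M)
    (hS : ∀ i, S i = T i ∨ S i = ∅)
    (hC : ∀ i, (T i : Set M).PairwiseDisjoint (competitors S i))
    {r : ℝ≥0} (hr : ∀ᵐ t ∂μ, t ≤ r)
    (hdev : ∀ i (d : M → ℝ≥0), ∏ j ∈ T i, μ.real (Iic (d j)) ^ (competitors S i j).card ≤
      ∑ j ∈ T i, d j * μ.real (Iic (d j)) ^ (competitors S i j).card)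
    (heq : ∀ i, S i = T i → ∀ᵐ t ∂μ, ∑ j ∈ T i, t * μ.real (Iic t) ^ (competitors S i j).card ≤
      ∏ j ∈ T i, μ.real (Iic t) ^ (competitors S i j).card) :
    IsMixedNash X (fun i => bundleValue (T i) 1) (fun i => μ.map (equalBid (S i))) where
  isProbabilityMeasure i := Measure.isProbabilityMeasure_map (measurable_equalBid _).aemeasurable
  integrable i := by
    rw [← (measurePreserving_equalBids μ S).integrable_comp
      (measurable_utility X _ i).aestronglyMeasurable]
    exact integrable_utility_equalBids μ X T S i hr
  best_response i d := by
    classical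
    have hmp := measurePreserving_equalBids μ S
    have hm : Measurable fun b : N → M → ℝ≥0 => update b i d := by
      refine measurable_pi_lambda _ fun a => ?_
      by_cases h : a = i
      · subst h; simp
      · simp only [update_of_ne h]
        exact measurable_pi_apply a
    have hu := measurable_utility X (fun i => bundleValue (T i) 1) i
    rw [← hmp.map_eq, integral_map hmp.aemeasurable hu.aestronglyMeasurable,
      integral_map (f := fun b => utility X (fun i => bundleValue (T i) 1) i (update b i d))
        hmp.aemeasurable (hu.comp hm).aestronglyMeasurable]
    refine ((integral_utility_update_le μ X T S i (hC i) d).trans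
      (sub_nonpos.2 (hdev i d))).trans ?_
    rcases hS i with h | h
    · exact integral_utility_equalBids_nonneg μ X T S i h (hC i) hr (heq i h)
    · refine integral_nonneg fun x => ?_
      simp only [utility, equalBids, h, equalBid_empty, Pi.zero_apply, NNReal.coe_zero,
        Finset.sum_const_zero, sub_zero, bundleValue]
      split_ifs <;> simp

end Nash

/-! ### The distribution of the bids -/

section Distribution

/-- The quantile function of the distribution with `Pr[x ≤ t] = (k t) ^ (1 / m)` on `[0, 1 / k]`. -/
def quantile (k m : ℕ) (u : unitInterval) : ℝ≥0 := unitInterval.toNNReal u ^ m / k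

/-- The distribution on `[0, 1 / k]` with `Pr[x ≤ t] = (k t) ^ (1 / m)`. -/
def bidDistribution (k m : ℕ) : Measure ℝ≥0 := (volume : Measure unitInterval).map (quantile k m)

theorem measurable_quantile (k m : ℕ) : Measurable (quantile k m) := by
  unfold quantile
  have := unitInterval.toNNReal_continuous.measurable
  fun_prop

instance (k m : ℕ) : IsProbabilityMeasure (bidDistribution k m) :=
  Measure.isProbabilityMeasure_map (measurable_quantile k m).aemeasurable

theorem quantile_le (k m : ℕ) (u : unitInterval) : quantile k m u ≤ 1 / k := by
  unfold quantile
  gcongr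
  exact pow_le_one₀ zero_le (by exact_mod_cast u.2.2)

theorem bidDistribution_ae_le (k m : ℕ) : ∀ᵐ t ∂(bidDistribution k m), t ≤ 1 / (k : ℝ≥0) := by
  rw [bidDistribution, ae_map_iff (measurable_quantile k m).aemeasurable measurableSet_Iic]
  exact .of_forall (quantile_le k m)

theorem injective_quantile {k m : ℕ} (hk : k ≠ 0) (hm : m ≠ 0) : Injective (quantile k m) := by
  intro u u' h
  unfold quantile at h
  have hk' : (k : ℝ≥0) ≠ 0 := by exact_mod_cast hk
  have := (pow_left_inj₀ zero_le zero_le hm).1 ((div_left_inj' hk').1 h)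
  exact Subtype.ext (congrArg NNReal.toReal this)

theorem nullSingletonClass_bidDistribution {k m : ℕ} (hk : k ≠ 0) (hm : m ≠ 0) :
    NullSingletonClass (bidDistribution k m) where
  measure_singleton t := by
    rw [bidDistribution, Measure.map_apply (measurable_quantile k m) (measurableSet_singleton t)]
    exact (subsingleton_singleton.preimage (injective_quantile hk hm)).measure_zero _

theorem bidDistribution_Iic {k m : ℕ} (hk : k ≠ 0) (hm : m ≠ 0) {t : ℝ≥0}
    (ht : (t : ℝ) ≤ 1 / k) :
    bidDistribution k m (Iic t) = ENNReal.ofReal ((k * t : ℝ) ^ (1 / (m : ℝ))) := by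
  have hk' : (0 : ℝ) < k := by positivity
  have hkt : (k * t : ℝ) ≤ 1 := by rw [le_div_iff₀ hk'] at ht; linarith
  have h0 : (0 : ℝ) ≤ k * t := by positivity
  have hmem : (k * t : ℝ) ^ (1 / (m : ℝ)) ∈ unitInterval :=
    ⟨by positivity, Real.rpow_le_one h0 hkt (by positivity)⟩
  have : quantile k m ⁻¹' Iic t = Iic ⟨_, hmem⟩ := by
    ext u
    rw [mem_preimage, mem_Iic, mem_Iic, ← Subtype.coe_le_coe, quantile, ← NNReal.coe_le_coe]
    have hu : ((unitInterval.toNNReal u : ℝ≥0) : ℝ) = u := rfl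
    push_cast
    rw [hu, div_le_iff₀ hk', mul_comm, one_div,
      Real.le_rpow_inv_iff_of_pos u.2.1 h0 (by positivity), Real.rpow_natCast]
  rw [bidDistribution, Measure.map_apply (measurable_quantile k m) measurableSet_Iic, this,
    unitInterval.volume_Iic]

theorem bidDistribution_real_Iic_pow {k m : ℕ} (hk : k ≠ 0) (hm : m ≠ 0) {t : ℝ≥0}
    (ht : (t : ℝ) ≤ 1 / k) : (bidDistribution k m).real (Iic t) ^ m = k * t := by
  rw [measureReal_def, bidDistribution_Iic hk hm ht, ENNReal.toReal_ofReal (by positivity),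
    one_div, Real.rpow_inv_natCast_pow (by positivity) hm]

theorem bidDistribution_real_Iic_pow_le {k m : ℕ} (hk : k ≠ 0) (hm : m ≠ 0) (t : ℝ≥0) :
    (bidDistribution k m).real (Iic t) ^ m ≤ k * t := by
  rcases le_total (t : ℝ) (1 / k) with ht | ht
  · exact (bidDistribution_real_Iic_pow hk hm ht).le
  · have hk' : (0 : ℝ) < k := by positivity
    rw [div_le_iff₀ hk'] at ht
    exact (pow_le_one₀ measureReal_nonneg measureReal_le_one).trans (by linarith)

end Distribution

/-! ### The inequality behind the equilibrium -/

section Inequality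

/-- The AM–GM inequality, for the `n`-th powers of `n` numbers. -/
theorem card_mul_prod_le_sum_pow {ι : Type*} (s : Finset ι) (y : ι → ℝ) (hs : s.Nonempty)
    (hy : ∀ i ∈ s, 0 ≤ y i) : s.card * ∏ i ∈ s, y i ≤ ∑ i ∈ s, y i ^ s.card := by
  have hc : (0 : ℝ) < s.card := by exact_mod_cast hs.card_pos
  have h := Real.geom_mean_le_arith_mean_weighted s (fun _ => (s.card : ℝ)⁻¹)
    (fun i => y i ^ s.card) (fun _ _ => by positivity) (by simp [hc.ne'])
    (fun i hi => pow_nonneg (hy i hi) _)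
  rw [← Finset.mul_sum, Finset.prod_congr rfl fun i hi =>
    Real.pow_rpow_inv_natCast (hy i hi) hs.card_ne_zero] at h
  calc _ ≤ s.card * ((s.card : ℝ)⁻¹ * ∑ i ∈ s, y i ^ s.card) := by gcongr
    _ = _ := by field_simp

/-- No deviation `d` from the equilibrium is profitable, for a bidder who wants a bundle `T` of `k`
items and has `c` competitors on each of them: `c = k - 1` for a line bidder, and `c = k` for an
auxiliary bidder. -/
theorem prod_pow_le_sum_mul_pow {M : Type*} {k m c : ℕ} (T : Finset M) (hT : T.card = k)
    (hk : k ≠ 0) (hm : m ≠ 0) (hc : m + c ≤ k * c) (d : M → ℝ≥0) :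
    ∏ j ∈ T, (bidDistribution k m).real (Iic (d j)) ^ c ≤
      ∑ j ∈ T, d j * (bidDistribution k m).real (Iic (d j)) ^ c := by
  have hk' : (0 : ℝ) < k := by positivity
  have h1 := card_mul_prod_le_sum_pow T (fun j => (bidDistribution k m).real (Iic (d j)) ^ c)
    (Finset.card_ne_zero.1 (hT ▸ hk)) fun _ _ => pow_nonneg measureReal_nonneg _
  rw [hT] at h1
  refine le_of_mul_le_mul_left (h1.trans ?_) hk'
  rw [Finset.mul_sum]
  refine Finset.sum_le_sum fun j _ => ?_
  calc (((bidDistribution k m).real (Iic (d j)) ^ c) ^ k)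
      = (bidDistribution k m).real (Iic (d j)) ^ (k * c) := by rw [← pow_mul, mul_comm]
    _ ≤ (bidDistribution k m).real (Iic (d j)) ^ (m + c) :=
        pow_le_pow_of_le_one measureReal_nonneg measureReal_le_one hc
    _ = (bidDistribution k m).real (Iic (d j)) ^ m *
          (bidDistribution k m).real (Iic (d j)) ^ c := pow_add ..
    _ ≤ (k * d j) * (bidDistribution k m).real (Iic (d j)) ^ c := by
        gcongr
        exact bidDistribution_real_Iic_pow_le hk hm _
    _ = _ := by ring

end Inequality

/-! ### Single-minded valuations -/

section SingleMinded

variable {M : Type*}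

theorem isMPH_bundleValue {k : ℕ} {T : Finset M} (hT : T.Nonempty) (hk : T.card ≤ k) :
    IsMPH k (bundleValue T 1) := by
  classical
  refine ⟨?_, ?_, {bundleValue T 1}, ?_, fun S => by simp⟩
  · simp [bundleValue, hT.ne_empty]
  · intro S S' h
    unfold bundleValue
    split_ifs with h1 h2
    · rfl
    · exact absurd (h1.trans h) h2
    · exact zero_le_one
    · rfl
  · rintro f rfl
    refine ⟨fun S => if S = T then 1 else 0, by simp [hT.ne_empty.symm], ?_, ?_, ?_⟩
    · intro S; dsimp only; split_ifs <;> simp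
    · intro S hS
      refine if_neg ?_
      rintro rfl
      omega
    · intro S
      simp [bundleValue]

theorem isSingleMinded_bundleValue {T : Finset M} (hT : T.Nonempty) :
    IsSingleMinded (bundleValue T 1) := ⟨T, 1, hT, one_pos, rfl⟩

theorem bundleValue_one_nonneg (T S : Finset M) : 0 ≤ bundleValue T 1 S := by
  unfold bundleValue; split_ifs <;> simp

end SingleMinded


/-! ### Copies of a projective plane -/

section Plane

variable {P L : Type*} [Fintype P] [Membership P L]

/-- The items on which the bidders bid in equilibrium: the auxiliary bidders do not bid. -/
def planeSupport (k : ℕ) : (Fin k × L) ⊕ P → Finset (Fin k × P)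
  | .inl a => planeBundle k (Sum.inl a : (Fin k × L) ⊕ P)
  | .inr _ => ∅

theorem planeStrategy_eq (k : ℕ) (μ : Measure ℝ≥0) [IsProbabilityMeasure μ] :
    planeStrategy (P := P) (L := L) k μ = fun i => μ.map (equalBid (planeSupport k i)) := by
  funext i
  rcases i with a | p
  · rfl
  · simp only [planeStrategy, planeSupport]
    have : equalBid (∅ : Finset (Fin k × P)) = fun _ => 0 := funext fun t => equalBid_empty t
    rw [this, Measure.map_const, measure_univ, one_smul]

theorem mem_planeBundle_inl {k : ℕ} {a : Fin k × L} {j : Fin k × P} :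
    j ∈ planeBundle k (Sum.inl a : (Fin k × L) ⊕ P) ↔ j.1 = a.1 ∧ j.2 ∈ a.2 := by
  simp [planeBundle]

theorem mem_planeBundle_inr {k : ℕ} {p : P} {j : Fin k × P} :
    j ∈ planeBundle k (Sum.inr p : (Fin k × L) ⊕ P) ↔ j.2 = p := by
  simp [planeBundle]

theorem card_planeBundle_inl [Finite L] [ProjectivePlane P L] {k : ℕ} (a : Fin k × L) :
    (planeBundle k (Sum.inl a : (Fin k × L) ⊕ P)).card = order P L + 1 := by
  classical
  have : planeBundle k (Sum.inl a : (Fin k × L) ⊕ P)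
      = {a.1} ×ˢ Finset.univ.filter fun p : P => p ∈ a.2 := by
    ext ⟨c, p⟩; simp only [mem_planeBundle_inl, Finset.mem_product, Finset.mem_singleton,
      Finset.mem_filter_univ]
  rw [this, Finset.card_product, Finset.card_singleton, one_mul, ← pointCount_eq P a.2, pointCount,
    Nat.card_eq_fintype_card, Fintype.card_subtype]

theorem card_planeBundle_inr {k : ℕ} (p : P) :
    (planeBundle k (Sum.inr p : (Fin k × L) ⊕ P)).card = k := by
  classical
  have : planeBundle k (Sum.inr p : (Fin k × L) ⊕ P) = Finset.univ ×ˢ {p} := by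
    ext ⟨c, q⟩; simp only [mem_planeBundle_inr, Finset.mem_product, Finset.mem_singleton,
      Finset.mem_univ, true_and]
  rw [this, Finset.card_product, Finset.card_singleton, mul_one, Finset.card_fin]

theorem card_planeBundle [Finite L] [ProjectivePlane P L] {k : ℕ} (hk : order P L + 1 = k)
    (i : (Fin k × L) ⊕ P) : (planeBundle k i).card = k := by
  rcases i with a | p
  · rw [card_planeBundle_inl, hk]
  · exact card_planeBundle_inr p

variable [Fintype L]

theorem mem_competitors_planeSupport {k : ℕ} {i a : (Fin k × L) ⊕ P} {j : Fin k × P} :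
    a ∈ competitors (planeSupport k) i j ↔
      a ≠ i ∧ ∃ l : L, a = Sum.inl (j.1, l) ∧ j.2 ∈ l := by
  rw [mem_competitors]
  refine and_congr_right fun _ => ?_
  rcases a with ⟨c, l⟩ | p
  · simp only [planeSupport, mem_planeBundle_inl, Sum.inl.injEq, Prod.mk.injEq]
    constructor
    · rintro ⟨h1, h2⟩
      exact ⟨l, ⟨h1.symm, rfl⟩, h2⟩
    · rintro ⟨l', ⟨h1, rfl⟩, h2⟩
      exact ⟨h1.symm, h2⟩
  · simp [planeSupport]

variable [ProjectivePlane P L]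

theorem card_competitors_inr {k : ℕ} (p : P) (j : Fin k × P) :
    (competitors (planeSupport k) (Sum.inr p : (Fin k × L) ⊕ P) j).card = order P L + 1 := by
  classical
  have : competitors (planeSupport k) (Sum.inr p : (Fin k × L) ⊕ P) j
      = (Finset.univ.filter fun l : L => j.2 ∈ l).image fun l => Sum.inl (j.1, l) := by
    ext a
    rw [mem_competitors_planeSupport]
    simp only [Finset.mem_image, Finset.mem_filter_univ]
    constructor
    · rintro ⟨_, l, rfl, h⟩
      exact ⟨l, h, rfl⟩
    · rintro ⟨l, h, rfl⟩
      exact ⟨by simp, l, rfl, h⟩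
  rw [this, Finset.card_image_of_injective _ fun l l' h => by simpa using h,
    ← lineCount_eq (L := L) j.2, lineCount, Nat.card_eq_fintype_card, Fintype.card_subtype]

theorem card_competitors_inl {k : ℕ} (a : Fin k × L) {j : Fin k × P}
    (hj : j ∈ planeBundle k (Sum.inl a : (Fin k × L) ⊕ P)) :
    (competitors (planeSupport k) (Sum.inl a : (Fin k × L) ⊕ P) j).card = order P L := by
  classical
  obtain ⟨c, l⟩ := a
  rw [mem_planeBundle_inl] at hj
  have : competitors (planeSupport k) (Sum.inl (c, l) : (Fin k × L) ⊕ P) j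
      = ((Finset.univ.filter fun l : L => j.2 ∈ l).erase l).image fun l => Sum.inl (j.1, l) := by
    ext a
    rw [mem_competitors_planeSupport]
    simp only [Finset.mem_image, Finset.mem_filter_univ, Finset.mem_erase]
    constructor
    · rintro ⟨h1, l', rfl, h⟩
      refine ⟨l', ⟨?_, h⟩, rfl⟩
      rintro rfl
      exact h1 (by rw [hj.1])
    · rintro ⟨l', ⟨h1, h⟩, rfl⟩
      exact ⟨by simp [h1], l', rfl, h⟩
  rw [this, Finset.card_image_of_injective _ fun l l' h => by simpa using h,
    Finset.card_erase_of_mem (by simpa using hj.2), ← Fintype.card_subtype,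
    ← Nat.card_eq_fintype_card]
  change lineCount L j.2 - 1 = _
  rw [lineCount_eq, Nat.add_sub_cancel]

/-- The items of a bidder have disjoint sets of competitors: another line of the same copy
shares only one point with a given line, and items of different copies have different
competitors. -/
theorem pairwiseDisjoint_competitors {k : ℕ} (i : (Fin k × L) ⊕ P) :
    (planeBundle k i : Set (Fin k × P)).PairwiseDisjoint (competitors (planeSupport k) i) := by
  intro j hj j' hj' hne
  refine Finset.disjoint_left.2 fun a ha ha' => hne ?_
  obtain ⟨h0, l, rfl, hl⟩ := mem_competitors_planeSupport.1 ha
  obtain ⟨-, l', h, hl'⟩ := mem_competitors_planeSupport.1 ha'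
  simp only [Sum.inl.injEq, Prod.mk.injEq] at h
  obtain ⟨h1, rfl⟩ := h
  rw [Finset.mem_coe] at hj hj'
  refine Prod.ext h1 ?_
  rcases i with ⟨c, m⟩ | p
  · rw [mem_planeBundle_inl] at hj hj'
    refine (Nondegenerate.eq_or_eq hl hl' hj.2 hj'.2).resolve_right ?_
    rintro rfl
    exact h0 (by rw [hj.1])
  · rw [mem_planeBundle_inr] at hj hj'
    rw [hj, hj']

theorem isMixedNash_planeStrategy {k : ℕ} (hk : order P L + 1 = k)
    (X : AllocationRule ((Fin k × L) ⊕ P) (Fin k × P)) :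
    IsMixedNash X (planeValuation k)
      (planeStrategy k (bidDistribution k ((k - 1) ^ 2))) := by
  have hn : 2 ≤ order P L := one_lt_order P L
  have hk1 : k - 1 = order P L := by omega
  have hk0 : k ≠ 0 := by omega
  have hm : (k - 1) ^ 2 ≠ 0 := pow_ne_zero _ (by omega)
  have := nullSingletonClass_bidDistribution hk0 hm
  rw [planeStrategy_eq]
  refine isMixedNash_equalBid _ X (planeBundle k) (planeSupport k) ?_ pairwiseDisjoint_competitors
    (bidDistribution_ae_le _ _) ?_ ?_
  · rintro (a | p)
    · exact .inl rfl
    · exact .inr rfl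
  · intro i d
    have key : ∃ c, (k - 1) ^ 2 + c ≤ k * c ∧
        ∀ j ∈ planeBundle k i, (competitors (planeSupport k) i j).card = c := by
      rcases i with a | p
      · refine ⟨order P L, ?_, fun j hj => card_competitors_inl a hj⟩
        rw [hk1, ← hk]; nlinarith
      · refine ⟨order P L + 1, ?_, fun j hj => card_competitors_inr p j⟩
        rw [hk1, ← hk]; nlinarith
    obtain ⟨c, hc, hcard⟩ := key
    rw [Finset.prod_congr rfl fun j hj => by rw [hcard j hj],
      Finset.sum_congr rfl fun j hj => by rw [hcard j hj]]
    exact prod_pow_le_sum_mul_pow _ (card_planeBundle hk i) hk0 hm hc d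
  · rintro (a | p) hi
    · filter_upwards [bidDistribution_ae_le k ((k - 1) ^ 2)] with t ht
      have ht' : (t : ℝ) ≤ 1 / k := by exact_mod_cast ht
      rw [Finset.prod_congr rfl fun j hj => by rw [card_competitors_inl a hj],
        Finset.sum_congr rfl fun j hj => by rw [card_competitors_inl a hj],
        Finset.prod_const, Finset.sum_const, card_planeBundle hk, nsmul_eq_mul, ← mul_assoc,
        ← bidDistribution_real_Iic_pow hk0 hm ht', ← pow_add, ← pow_mul]
      refine le_of_eq (congrArg _ ?_)
      rw [hk1, ← hk]; ring
    · have := card_planeBundle_inr (L := L) (k := k) p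
      rw [← hi] at this
      exact absurd this.symm hk0

/-- If the draws of the bidders are distinct and positive, then in each copy exactly the line bidder
with the highest draw wins his bundle. -/
theorem welfare_equalBids_planeSupport {k : ℕ} (hk : k ≠ 0)
    (X : AllocationRule ((Fin k × L) ⊕ P) (Fin k × P))
    {x : (Fin k × L) ⊕ P → ℝ≥0} (hinj : Injective x) (hpos : ∀ a, x a ≠ 0) :
    welfare (planeValuation k) (X.winner (equalBids (planeSupport k) x)) = k := by
  classical
  set b := equalBids (planeSupport k) x with hb
  have hbid : ∀ (c : Fin k) (l : L) (p : P), p ∈ l →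
      b (Sum.inl (c, l)) (c, p) = x (Sum.inl (c, l)) :=
    fun c l p h => equalBid_of_mem (T := planeBundle k (Sum.inl (c, l) : (Fin k × L) ⊕ P))
      (mem_planeBundle_inl.2 ⟨rfl, h⟩) _
  have hbid0 : ∀ (p : P) (j : Fin k × P), b (Sum.inr p) j = 0 := fun p j =>
    equalBid_of_notMem (by simp [planeSupport]) _
  obtain ⟨p₀, _, _, l₀, _⟩ := @exists_config P L _ _
  have : Nonempty L := ⟨l₀⟩
  -- `top c` is the line of copy `c` with the highest draw
  choose top htop using fun c : Fin k => Finite.exists_max fun l : L => x (Sum.inl (c, l))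
  have hwin : ∀ (c : Fin k) (p : P), p ∈ top c → X.winner b (c, p) = Sum.inl (c, top c) := by
    intro c p hp
    by_contra hne
    have h := X.highest b (c, p) (Sum.inl (c, top c))
    rw [hbid c (top c) p hp] at h
    have hmem : X.winner b (c, p) ∈ competitors (planeSupport k) (Sum.inl (c, top c)) (c, p) := by
      refine mem_competitors.2 ⟨hne, ?_⟩
      by_contra hn
      rw [hb, equalBids, equalBid_of_notMem hn] at h
      exact hpos _ (le_antisymm h zero_le)
    obtain ⟨-, l, hl, hpl⟩ := mem_competitors_planeSupport.1 hmem
    rw [hl, hbid c l p hpl] at h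
    rw [hl] at hne
    exact hne (hinj (le_antisymm (htop c l) h))
  have haux : ∀ p : P, planeValuation k (Sum.inr p : (Fin k × L) ⊕ P)
      (bundle (X.winner b) (Sum.inr p)) = 0 := by
    intro p
    refine if_neg fun hsub => ?_
    let c : Fin k := ⟨0, Nat.pos_of_ne_zero hk⟩
    have h : X.winner b (c, p) = Sum.inr p := mem_bundle.1 (hsub (mem_planeBundle_inr.2 rfl))
    obtain ⟨l, hl⟩ : ∃ l : L, p ∈ l := by
      have : 0 < lineCount L p := (two_lt_lineCount (L := L) p).trans' (by norm_num)
      obtain ⟨⟨l, hl⟩⟩ := (Nat.card_pos_iff.1 this).1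
      exact ⟨l, hl⟩
    have h2 := X.highest b (c, p) (Sum.inl (c, l))
    rw [h, hbid0, hbid c l p hl] at h2
    exact hpos _ (le_antisymm h2 zero_le)
  have hline : ∀ (c : Fin k) (l : L), planeValuation k (Sum.inl (c, l) : (Fin k × L) ⊕ P)
      (bundle (X.winner b) (Sum.inl (c, l))) = if l = top c then 1 else 0 := by
    intro c l
    suffices h : planeBundle k (Sum.inl (c, l) : (Fin k × L) ⊕ P)
        ⊆ bundle (X.winner b) (Sum.inl (c, l)) ↔ l = top c by
      simp only [planeValuation, bundleValue, h]
    constructor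
    · intro hsub
      by_contra hne
      obtain ⟨h1, h2⟩ := HasPoints.mkPoint_ax (P := P) hne
      have h3 := hwin c _ h2
      rw [mem_bundle.1 (hsub (mem_planeBundle_inl.2 ⟨rfl, h1⟩))] at h3
      simp only [Sum.inl.injEq, Prod.mk.injEq, true_and] at h3
      exact hne h3
    · rintro rfl ⟨c', p⟩ hj
      obtain ⟨rfl, hp⟩ := mem_planeBundle_inl.1 hj
      exact mem_bundle.2 (hwin _ p hp)
  rw [welfare, Fintype.sum_sum_type, Fintype.sum_prod_type]
  simp [haux, hline]

theorem expectedWelfare_planeStrategy {k : ℕ} (hk : k ≠ 0) (μ : Measure ℝ≥0)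
    [IsProbabilityMeasure μ] [NullSingletonClass μ]
    (X : AllocationRule ((Fin k × L) ⊕ P) (Fin k × P)) :
    expectedWelfare X (planeValuation k) (planeStrategy k μ) = k := by
  have hmp := measurePreserving_equalBids μ (planeSupport (P := P) (L := L) k)
  rw [expectedWelfare, planeStrategy_eq, ← hmp.map_eq, integral_map hmp.aemeasurable
    (measurable_comp_winner X (welfare (planeValuation k))).aestronglyMeasurable]
  have h0 : ∀ᵐ t ∂μ, t ≠ 0 := ae_iff.2 (by simp)
  rw [integral_congr_ae (g := fun _ => (k : ℝ))]
  · simp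
  · filter_upwards [ae_injective μ, ae_forall_pi μ h0] with x hx hx0
    exact welfare_equalBids_planeSupport hk X hx hx0

/-- The optimum gives all items to the auxiliary bidders. It is optimal because all the disjoint
bundles that are won have the same size. -/
theorem opt_planeValuation {k : ℕ} (hk : order P L + 1 = k) :
    opt (planeValuation (P := P) (L := L) k) = k * ((k : ℝ) - 1) + 1 := by
  classical
  have hcard : (Fintype.card P : ℝ) = k * ((k : ℝ) - 1) + 1 := by
    rw [card_points P L, ← hk]; push_cast; ring
  rw [← hcard]
  have hk0 : (0 : ℝ) < k := by rw [← hk]; positivity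
  obtain ⟨p₀, _⟩ := @exists_config P L _ _
  have : Nonempty (Fin k × P → (Fin k × L) ⊕ P) := ⟨fun _ => Sum.inr p₀⟩
  refine le_antisymm (ciSup_le fun A => ?_) ?_
  · refine le_of_mul_le_mul_left ?_ hk0
    calc (k : ℝ) * welfare (planeValuation k) A
        = ∑ i, k * planeValuation k i (bundle A i) := Finset.mul_sum ..
      _ ≤ ∑ i, ((bundle A i).card : ℝ) := by
          refine Finset.sum_le_sum fun i _ => ?_
          simp only [planeValuation, bundleValue]
          split_ifs with h
          · have := Finset.card_le_card h
            rw [card_planeBundle hk] at this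
            simpa using this
          · simp
      _ = (Fintype.card (Fin k × P) : ℝ) := by
          rw [← Finset.card_univ, ← Nat.cast_sum,
            Finset.card_eq_sum_card_fiberwise (f := A) (t := Finset.univ) (fun _ _ => by simp)]
          push_cast
          refine Finset.sum_congr rfl fun i _ => ?_
          congr 2
          ext j
          simp [bundle]
      _ = k * Fintype.card P := by simp
  · refine le_trans ?_ (le_ciSup (Set.finite_range _).bddAbove fun j => Sum.inr j.2)
    rw [welfare, Fintype.sum_sum_type]
    refine le_add_of_nonneg_of_le (Finset.sum_nonneg fun _ _ => bundleValue_one_nonneg _ _) ?_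
    rw [← Finset.card_univ, ← nsmul_one, ← Finset.sum_const]
    refine Finset.sum_le_sum fun p _ => (if_pos ?_).ge
    intro j hj
    exact mem_bundle.2 (congrArg Sum.inr (mem_planeBundle_inr.1 hj))

end Plane

/-! ### Lower bounds on the price of anarchy -/

section PriceOfAnarchy

theorem IsMPH.mono {M : Type*} {k k' : ℕ} (h : k ≤ k') {v : Finset M → ℝ} (hv : IsMPH k v) :
    IsMPH k' v := by
  obtain ⟨h0, hm, 𝓛, h𝓛, hg⟩ := hv
  refine ⟨h0, hm, 𝓛, fun f hf => ?_, hg⟩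
  obtain ⟨g, g0, gn, gk, gs⟩ := h𝓛 f hf
  exact ⟨g, g0, gn, fun T hT => gk T (h.trans_lt hT), gs⟩

theorem ofReal_le_priceOfAnarchy {N M : Type*} [Fintype N] [Fintype M] {X : AllocationRule N M}
    {v : N → Finset M → ℝ} {B : N → Measure (M → ℝ≥0)} (hB : IsMixedNash X v B) {r : ℝ}
    (hw : 0 < expectedWelfare X v B) (hr : r * expectedWelfare X v B ≤ opt v) :
    ENNReal.ofReal r ≤ priceOfAnarchy X v := by
  refine le_trans ?_ (le_iSup₂ (f := fun B (_ : IsMixedNash X v B) =>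
    ENNReal.ofReal (opt v) / ENNReal.ofReal (expectedWelfare X v B)) B hB)
  rw [← ENNReal.ofReal_div_of_pos hw]
  exact ENNReal.ofReal_le_ofReal ((le_div_iff₀ hw).2 hr)

/-- With a single bidder and a single item, bidding `0` is an equilibrium. -/
theorem one_le_priceOfAnarchy_single (X : AllocationRule Unit Unit) :
    1 ≤ priceOfAnarchy X (fun _ : Unit => bundleValue (Finset.univ : Finset Unit) 1) := by
  have hbundle : ∀ A : Unit → Unit, bundle A () = Finset.univ := fun A => by ext; simp [mem_bundle]
  have hwel : ∀ A : Unit → Unit,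
      welfare (fun _ : Unit => bundleValue (Finset.univ : Finset Unit) 1) A = 1 := fun A => by
    simp [welfare, hbundle, bundleValue]
  have hut : ∀ b, utility X (fun _ : Unit => bundleValue (Finset.univ : Finset Unit) 1) () b
      = 1 - b () () := fun b => by
    simp [utility, hbundle, bundleValue]
  have hpi : Measure.pi (fun _ : Unit => Measure.dirac (0 : Unit → ℝ≥0)) = Measure.dirac 0 :=
    Measure.pi_eq fun s hs => by
      rw [Measure.dirac_apply' _ (.univ_pi hs), Finset.univ_unique, Finset.prod_singleton,
        Measure.dirac_apply' _ (hs _)]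
      refine indicator_eq_indicator ?_ rfl
      exact ⟨fun h => mem_univ_pi.1 h _, fun h => mem_univ_pi.2 fun _ => h⟩
  have hB : IsMixedNash X (fun _ : Unit => bundleValue (Finset.univ : Finset Unit) 1)
      (fun _ => Measure.dirac 0) := by
    refine ⟨fun _ => inferInstance, fun i => ?_, fun i d => ?_⟩
    · rw [hpi]
      exact integrable_dirac' (measurable_utility X _ _).stronglyMeasurable enorm_lt_top
    · rw [hpi, integral_dirac, integral_dirac, hut, hut]
      simp
  have hew : expectedWelfare X (fun _ : Unit => bundleValue (Finset.univ : Finset Unit) 1)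
      (fun _ => Measure.dirac 0) = 1 := by
    simp only [expectedWelfare, hwel, hpi, integral_dirac]
  rw [← ENNReal.ofReal_one]
  refine ofReal_le_priceOfAnarchy hB (by rw [hew]; exact one_pos) ?_
  simp only [hew, opt, hwel, ciSup_const, mul_one, le_refl]

theorem order_projectivization (p : ℕ) [Fact p.Prime] :
    order (Projectivization (ZMod p) (Fin 3 → ZMod p))
      (Projectivization (ZMod p) (Fin 3 → ZMod p)) = p := by
  have : Fintype (Projectivization (ZMod p) (Fin 3 → ZMod p)) := Fintype.ofFinite _
  have h := card_points (Projectivization (ZMod p) (Fin 3 → ZMod p))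
    (Projectivization (ZMod p) (Fin 3 → ZMod p))
  have h2 := Projectivization.card_of_finrank (ZMod p) (Fin 3 → ZMod p) (n := 3) (by simp)
  rw [Nat.card_eq_fintype_card, h, Nat.card_zmod, Finset.sum_range_succ, Finset.sum_range_succ,
    Finset.sum_range_one] at h2
  nlinarith

theorem exists_prime_add_one_le_and_le_two_mul {k : ℕ} (hk : 3 ≤ k) :
    ∃ p, p.Prime ∧ p + 1 ≤ k ∧ k ≤ 2 * p := by
  obtain ⟨p, hp, h1, h2⟩ := Nat.bertrand ((k - 1) / 2) (by omega)
  exact ⟨p, hp, by omega, by omega⟩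

end PriceOfAnarchy

end FirstPrice

end

theorem theorem4 :
    (∀ (P L : Type) [Fintype P] [Fintype L] [Membership P L]
        [Configuration.ProjectivePlane P L] (k : ℕ),
        Configuration.ProjectivePlane.order P L + 1 = k →
        (∀ i : (Fin k × L) ⊕ P,
          FirstPrice.IsSingleMinded (FirstPrice.planeValuation k i) ∧
            FirstPrice.IsMPH k (FirstPrice.planeValuation k i)) ∧
        FirstPrice.opt (FirstPrice.planeValuation (P := P) (L := L) k) =
          (k : ℝ) * ((k : ℝ) - 1) + 1 ∧
        ∃ μ : Measure ℝ≥0, IsProbabilityMeasure μ ∧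
          (∀ t : ℝ≥0, (t : ℝ) ≤ 1 / (k : ℝ) →
            μ (Set.Iic t) = ENNReal.ofReal (((k : ℝ) * t) ^ (1 / ((k : ℝ) - 1) ^ 2))) ∧
          ∀ X : FirstPrice.AllocationRule ((Fin k × L) ⊕ P) (Fin k × P),
            FirstPrice.IsMixedNash X (FirstPrice.planeValuation k)
              (FirstPrice.planeStrategy k μ) ∧
            FirstPrice.expectedWelfare X (FirstPrice.planeValuation k)
              (FirstPrice.planeStrategy k μ) = k) ∧
    ∃ c : ℝ, 0 < c ∧ ∀ k : ℕ, 1 ≤ k →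
      ∃ (N M : Type) (_ : Fintype N) (_ : Nonempty N) (_ : Fintype M)
        (v : N → Finset M → ℝ),
        (∀ i, FirstPrice.IsSingleMinded (v i) ∧ FirstPrice.IsMPH k (v i)) ∧
        ∀ X : FirstPrice.AllocationRule N M,
          ENNReal.ofReal (c * k) ≤ FirstPrice.priceOfAnarchy X v := by
  have valuations : ∀ (P L : Type) [Fintype P] [Fintype L] [Membership P L]
      [Configuration.ProjectivePlane P L] (k : ℕ),
      Configuration.ProjectivePlane.order P L + 1 = k → ∀ i : (Fin k × L) ⊕ P,
        FirstPrice.IsSingleMinded (FirstPrice.planeValuation k i) ∧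
          FirstPrice.IsMPH k (FirstPrice.planeValuation k i) := by
    intro P L _ _ _ _ k hk i
    have hcard := FirstPrice.card_planeBundle hk i
    have hne : (FirstPrice.planeBundle k i).Nonempty := Finset.card_pos.1 (by omega)
    exact ⟨FirstPrice.isSingleMinded_bundleValue hne, FirstPrice.isMPH_bundleValue hne hcard.le⟩
  refine ⟨fun P L _ _ _ _ k hk => ?_, 1 / 2, by norm_num, fun k hk => ?_⟩
  · have hn := Configuration.ProjectivePlane.one_lt_order P L
    have hk0 : k ≠ 0 := by omega
    have hm : (k - 1) ^ 2 ≠ 0 := pow_ne_zero _ (by omega)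
    have := FirstPrice.nullSingletonClass_bidDistribution hk0 hm
    refine ⟨valuations P L k hk, FirstPrice.opt_planeValuation hk,
      FirstPrice.bidDistribution k ((k - 1) ^ 2), inferInstance, fun t ht => ?_, fun X =>
      ⟨FirstPrice.isMixedNash_planeStrategy hk X,
        FirstPrice.expectedWelfare_planeStrategy hk0 _ X⟩⟩
    rw [FirstPrice.bidDistribution_Iic hk0 hm ht, Nat.cast_pow,
      Nat.cast_sub (Nat.one_le_iff_ne_zero.2 hk0), Nat.cast_one]
  · rcases Nat.lt_or_ge k 3 with hk3 | hk3
    · refine ⟨Unit, Unit, inferInstance, inferInstance, inferInstance,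
        fun _ => FirstPrice.bundleValue Finset.univ 1, fun _ =>
        ⟨FirstPrice.isSingleMinded_bundleValue Finset.univ_nonempty,
          FirstPrice.isMPH_bundleValue Finset.univ_nonempty (by simpa using hk)⟩, fun X =>
        le_trans ?_ (FirstPrice.one_le_priceOfAnarchy_single X)⟩
      have : (k : ℝ) ≤ 2 := by exact_mod_cast Nat.le_of_lt_succ hk3
      rw [← ENNReal.ofReal_one]
      exact ENNReal.ofReal_le_ofReal (by linarith)
    · obtain ⟨p, hp, hpk, hkp⟩ := FirstPrice.exists_prime_add_one_le_and_le_two_mul hk3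
      have : Fact p.Prime := ⟨hp⟩
      let Q : Type := Projectivization (ZMod p) (Fin 3 → ZMod p)
      have : Fintype Q := Fintype.ofFinite _
      have hord : Configuration.ProjectivePlane.order Q Q + 1 = p + 1 := by
        rw [FirstPrice.order_projectivization p]
      have hm : (p + 1 - 1) ^ 2 ≠ 0 := pow_ne_zero _ (by simpa using hp.ne_zero)
      have := FirstPrice.nullSingletonClass_bidDistribution p.succ_ne_zero hm
      obtain ⟨q⟩ : Nonempty Q := by
        obtain ⟨q, -⟩ := @Configuration.ProjectivePlane.exists_config Q Q _ _
        exact ⟨q⟩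
      refine ⟨(Fin (p + 1) × Q) ⊕ Q, Fin (p + 1) × Q, inferInstance, ⟨Sum.inr q⟩, inferInstance,
        FirstPrice.planeValuation (p + 1), fun i =>
        ⟨(valuations Q Q _ hord i).1, (valuations Q Q _ hord i).2.mono hpk⟩, fun X => ?_⟩
      have hw := FirstPrice.expectedWelfare_planeStrategy p.succ_ne_zero
        (FirstPrice.bidDistribution (p + 1) ((p + 1 - 1) ^ 2)) X
      refine FirstPrice.ofReal_le_priceOfAnarchy
        (FirstPrice.isMixedNash_planeStrategy hord X) ?_ ?_
      · rw [hw]; positivity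
      · rw [hw, FirstPrice.opt_planeValuation hord]
        have : (k : ℝ) ≤ 2 * p := by exact_mod_cast hkp
        push_cast
        nlinarith [(Nat.cast_nonneg p : (0 : ℝ) ≤ p)]
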